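/- **Setting.** Let $\mathcal X\subset\mathbb R^p$ and $\mathcal Y\subset\mathbb R$ be compact, and let $\mathcal H$ be a real reproducing kernel Hilbert space of measurable functions on $\mathcal X$ with kernel $\kappa$ such that $\sup_{x\in\mathcal X}\sqrt{\kappa(x,x)}<\infty$. Let $\ell:\mathbb R\times\mathcal Y\to\mathbb R$ be a loss that is measurable in its second argument and such that, for every $y\in\mathcal Y$, the map $z\mapsto\ell(z,y)$ is convex, differentiable (with derivative $\ell'(z,y)$) and $C$-Lipschitz, with $C$ not depending on $y$. Let $(x_t,y_t)_{t\ge 0}$ be i.i.d. with the law of a random pair $(x,y)\in\mathcal X\times\mathcal Y$ for which $\mathbb E|\ell(0,y)|<\infty$. For $\lambda>0$ put $R(f)=\mathbb E[\ell(f(x),y)]+\frac\lambda2\|f\|_{\mathcal H}^2$, and let $f^*\in\mathcal H$ be the minimizer of $R$ over $\mathcal H$. **Algorithm (POLK).** A dictionary is a finite list $D=[d_1,\dots,d_M]$ of observed feature vectors, and $\mathcal H_D=\operatorname{span}\{\kappa(d_n,\cdot)\}_{n\le M}$. Start from $f_0=0$ with the empty dictionary $D_0$. With step size $\eta>0$ and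 budget $\epsilon>0$, at time $t$ form $$\tilde f_{t+1}=(1-\eta\lambda)f_t-\eta\,\ell'(f_t(x_t),y_t)\,\kappa(x_t,\cdot)$$ with dictionary $\tilde D_{t+1}=[D_t,x_t]$ and the corresponding coefficients, and apply destructive kernel orthogonal matching pursuit to it: as long as the current dictionary $D$ is non-empty, find an element $d_j$ of $D$ whose removal error $\gamma_j=\min_{g\in\mathcal H_{D\setminus\{d_j\}}}\|\tilde f_{t+1}-g\|_{\mathcal H}$ is smallest; if $\gamma_j>\epsilon$, stop; otherwise remove $d_j$ from $D$, refit the coefficients by least squares to $\tilde f_{t+1}$, and repeat. The resulting dictionary and function are $D_{t+1}$ and $f_{t+1}$. Ties may be broken in any way that does not look at future samples: there is a filtration $(\mathcal F_t)$, the algorithm history before $(x_t,y_t)$ is drawn, such that $f_t$ and $(x_u,y_u)_{u<t}$ are $\mathcal F_t$-measurable and $(x_t,y_t)$ is independent of $\mathcal F_t$. Let $P_{t+1}$ be the orthogonal projection of $\mathcal H$ onto $\mathcal H_{D_{t+1}}$, and put $$\hat\nabla_t=\ell'(f_t(x_t),y_t)\,\kappa(x_t,\cdot)+\lambda f_t,\qquad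 \tilde\nabla_t=\frac1\eta\bigl(f_t-P_{t+1}[f_t-\eta\hat\nabla_t]\bigr).$$ Assume that $\mathbb E\bigl[\|\tilde\nabla_t\|_{\mathcal H}^2\mid\mathcal F_t\bigr]\le\sigma^2$ almost surely for every $t$. **Theorem.** Let $0<\eta<1/\lambda$ be constant, and let $\epsilon=K\eta^{3/2}$ with a constant $K>0$. Then, almost surely, $$\liminf_{t\to\infty}\|f_t-f^*\|_{\mathcal H}\le\frac{\sqrt\eta}{\lambda}\Bigl(K+\sqrt{K^2+\lambda\sigma^2}\Bigr),$$ and, for fixed $\lambda$, $K$ and $\sigma$, the right-hand side is $O(\sqrt\eta)$ as $\eta\to0^+$. -/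

import Mathlib

open MeasureTheory ProbabilityTheory Filter Topology Asymptotics

namespace POLK

noncomputable section

/- Throughout, `H` is a real reproducing kernel Hilbert space of functions `X → ℝ`; elements of `H`
are evaluated as functions, `f x`. -/

/-- The kernel section `κ(x, ·)`, an element of `H`. -/
def feature {X : Type*} (H : Type*) [NormedAddCommGroup H] [InnerProductSpace ℝ H]
    [CompleteSpace H] [RKHS ℝ H X ℝ] (x : X) : H :=
  RKHS.kerFun H x 1

/-- The scalar reproducing kernel `κ(x, x')` of `H`. -/
def kappa {X : Type*} (H : Type*) [NormedAddCommGroup H] [InnerProductSpace ℝ H]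
    [CompleteSpace H] [RKHS ℝ H X ℝ] (x x' : X) : ℝ :=
  RKHS.kernel H x x' 1

/-- The kernel expansion `∑_{k ∈ I} w_k κ(d_k, ·)`: the function with dictionary `(d_k)_{k ∈ I}`
and coefficients `(w_k)_{k ∈ I}`. Coefficients outside `I` are irrelevant. -/
def expansion {X ι : Type*} (H : Type*) [NormedAddCommGroup H] [InnerProductSpace ℝ H]
    [CompleteSpace H] [RKHS ℝ H X ℝ] (d : ι → X) (I : Finset ι) (w : ι → ℝ) : H :=
  ∑ k ∈ I, w k • feature H (d k)

/-- The subspace `span {κ(d_k, ·) : k ∈ I}` of `H` that belongs to a dictionary. -/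
def dictSpan {X ι : Type*} (H : Type*) [NormedAddCommGroup H] [InnerProductSpace ℝ H]
    [CompleteSpace H] [RKHS ℝ H X ℝ] (d : ι → X) (I : Finset ι) : Submodule ℝ H :=
  Submodule.span ℝ ((fun k => feature H (d k)) '' (I : Set ι))

instance instFiniteDimensionalDictSpan {X ι : Type*} (H : Type*) [NormedAddCommGroup H]
    [InnerProductSpace ℝ H] [CompleteSpace H] [RKHS ℝ H X ℝ] (d : ι → X) (I : Finset ι) :
    FiniteDimensional ℝ (dictSpan H d I) :=
  FiniteDimensional.span_of_finite ℝ (I.finite_toSet.image _)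

/-- The error `γ_j = min_w ‖f̃ - ∑_{k ∈ I \ {j}} w_k κ(d_k, ·)‖` of removing the dictionary
element `j`. -/
def removalError {X ι : Type*} [DecidableEq ι] {H : Type*} [NormedAddCommGroup H]
    [InnerProductSpace ℝ H] [CompleteSpace H] [RKHS ℝ H X ℝ] (d : ι → X) (ftil : H)
    (I : Finset ι) (j : ι) : ℝ :=
  ⨅ w : ι → ℝ, ‖ftil - expansion H d (I.erase j) w‖

/-- The states `(I, w)` that the loop of destructive kernel orthogonal matching pursuit can reach
from the input dictionary `(d_k)_{k ∈ Itil}` with coefficients `wtil` and budget `ε`. One pass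
removes an index with the smallest removal error, provided that this error is at most `ε`, and
then refits the coefficients to the input function by least squares. Ties may be broken in
any way. -/
inductive KOMPReaches {X ι : Type*} [DecidableEq ι] (H : Type*) [NormedAddCommGroup H]
    [InnerProductSpace ℝ H] [CompleteSpace H] [RKHS ℝ H X ℝ] (d : ι → X) (Itil : Finset ι)
    (wtil : ι → ℝ) (ε : ℝ) : Finset ι → (ι → ℝ) → Prop
  | init : KOMPReaches H d Itil wtil ε Itil wtil
  | prune {I : Finset ι} {w : ι → ℝ} (j : ι) (w' : ι → ℝ) :
      KOMPReaches H d Itil wtil ε I w →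
      j ∈ I →
      (∀ k ∈ I, removalError d (expansion H d Itil wtil) I j ≤
        removalError d (expansion H d Itil wtil) I k) →
      removalError d (expansion H d Itil wtil) I j ≤ ε →
      (∀ v : ι → ℝ, ‖expansion H d Itil wtil - expansion H d (I.erase j) w'‖ ≤
        ‖expansion H d Itil wtil - expansion H d (I.erase j) v‖) →
      KOMPReaches H d Itil wtil ε (I.erase j) w'

/-- `(I, w)` is an output of destructive KOMP: it is reached, and the loop stops there, because no
index is left or because the smallest removal error exceeds the budget. -/
def IsKOMPOutput {X ι : Type*} [DecidableEq ι] (H : Type*) [NormedAddCommGroup H]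
    [InnerProductSpace ℝ H] [CompleteSpace H] [RKHS ℝ H X ℝ] (d : ι → X) (Itil : Finset ι)
    (wtil : ι → ℝ) (ε : ℝ) (I : Finset ι) (w : ι → ℝ) : Prop :=
  KOMPReaches H d Itil wtil ε I w ∧
    ∀ j ∈ I, ε < removalError d (expansion H d Itil wtil) I j

/-- The derivative `ℓ'(z, y)` of the loss in its first, scalar argument. -/
def lossDeriv {Y : Type*} (ℓ : ℝ → Y → ℝ) (z : ℝ) (y : Y) : ℝ :=
  deriv (fun u => ℓ u y) z

/-- A run of POLK on the data `(x_t, y_t)`, with step sizes `η_t`, budgets `ε_t` and regularizer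
`lam`. A dictionary element is labelled by the time at which it was observed, so the dictionary at
time `t` is `(x_i)_{i ∈ I t}`, with coefficients `(w t i)_{i ∈ I t}`. Step `t` rescales the old
coefficients by `1 - η_t lam`, appends the label `t` with coefficient `-η_t ℓ'(f_t(x_t), y_t)`, and
applies KOMP with budget `ε_t`. -/
structure IsPOLKRun {X Y : Type*} (H : Type*) [NormedAddCommGroup H] [InnerProductSpace ℝ H]
    [CompleteSpace H] [RKHS ℝ H X ℝ] (ℓ : ℝ → Y → ℝ) (lam : ℝ) (η ε : ℕ → ℝ)
    (x : ℕ → X) (y : ℕ → Y) (I : ℕ → Finset ℕ) (w : ℕ → ℕ → ℝ) : Prop where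
  init : I 0 = ∅
  step : ∀ t : ℕ, IsKOMPOutput H x (insert t (I t))
    (fun i => if i = t then - η t * lossDeriv ℓ (expansion H x (I t) (w t) (x t)) (y t)
      else (1 - η t * lam) * w t i)
    (ε t) (I (t + 1)) (w (t + 1))

/-- The regularized stochastic gradient `ℓ'(f(x), y) κ(x, ·) + lam f` at the sample `(x, y)`. -/
def stochGrad {X Y : Type*} {H : Type*} [NormedAddCommGroup H] [InnerProductSpace ℝ H]
    [CompleteSpace H] [RKHS ℝ H X ℝ] (ℓ : ℝ → Y → ℝ) (lam : ℝ) (f : H) (x : X) (y : Y) : H :=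
  lossDeriv ℓ (f x) y • feature H x + lam • f

/-- The projected stochastic gradient `(f - P[f - η g]) / η`, where `g` is the regularized
stochastic gradient of `f` at `(x, y)` and `P` is the orthogonal projection onto the subspace of
the dictionary `(d_k)_{k ∈ I}`. -/
def projGrad {X Y ι : Type*} {H : Type*} [NormedAddCommGroup H] [InnerProductSpace ℝ H]
    [CompleteSpace H] [RKHS ℝ H X ℝ] (ℓ : ℝ → Y → ℝ) (lam η : ℝ) (d : ι → X) (I : Finset ι)
    (f : H) (x : X) (y : Y) : H :=
  η⁻¹ • (f - (dictSpan H d I).starProjection (f - η • stochGrad ℓ lam f x y))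

/-- The regularized expected risk `R(f) = E[ℓ(f(x), y)] + (lam / 2) ‖f‖²` for `(x, y)` with
law `P`. -/
def risk {X Y : Type*} [MeasurableSpace X] [MeasurableSpace Y] {H : Type*} [NormedAddCommGroup H]
    [InnerProductSpace ℝ H] [CompleteSpace H] [RKHS ℝ H X ℝ] (ℓ : ℝ → Y → ℝ) (lam : ℝ)
    (P : Measure (X × Y)) (f : H) : ℝ :=
  (∫ q, ℓ (f q.1) q.2 ∂P) + lam / 2 * ‖f‖ ^ 2

end

end POLK

/-! Put `d = ‖f_t - f*‖`. KOMP measures every removal error against its original input, so a whole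
pruning pass moves the stochastic gradient step by at most `ε`, and `f_t - f_{t+1}` is `η` times the
projected gradient. Expanding the square gives, pathwise, `d_{t+1}² ≤ d² - 2η⟨f_t - f*, ∇̂_t⟩ + 2εd
+ η²‖∇̃_t‖²`.

Averaging over the fresh sample uses strong convexity twice: the gradient inequality keeps a term
`lam/2 · d²`, and the growth of the risk at its minimizer gives another. The conditional mean of
`d_{t+1}²` is therefore at most `(1 - 2ηlam)d² + 2εd + η²σ²` (`setIntegral_norm_sub_sq_le`). Let `r`
be the claimed bound, the positive root of `lam d² - 2K√η d - ησ²`. Where `d ≥ r`, one of the two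
contractions `ηlam d²` pays for both error terms, and the factor `1 - ηlam` remains. The probability
of staying above `r` for `n` more steps then decays geometrically, so `d ≤ r` infinitely often
almost surely (`ae_frequently_le_of_contraction`).

Conditional inequalities are stated as integrals over events of the past. -/

namespace POLK

/-! ### Kernel expansions, and KOMP as an orthogonal projection. -/

section Kernel

variable {X : Type*} {H : Type*} [NormedAddCommGroup H] [InnerProductSpace ℝ H]
  [CompleteSpace H] [RKHS ℝ H X ℝ]

/-- The reproducing property. -/
lemma inner_feature (h : H) (x : X) : inner ℝ h (feature H x) = h x := by
  simp [feature, RKHS.inner_kerFun]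

lemma sqrt_kappa_eq_norm_feature (x : X) : √(kappa H x x) = ‖feature H x‖ := by
  have h : kappa H x x = ‖feature H x‖ ^ 2 := by
    rw [← real_inner_self_eq_norm_sq, inner_feature, feature, RKHS.kerFun_apply, kappa]
  rw [h, Real.sqrt_sq (norm_nonneg _)]

lemma abs_apply_le {B : ℝ} (hB : ∀ x : X, ‖feature H x‖ ≤ B) (h : H) (x : X) :
    |h x| ≤ B * ‖h‖ := by
  rw [← inner_feature, mul_comm]
  exact (abs_real_inner_le_norm _ _).trans (by gcongr; exact hB x)

variable {ι : Type*} (d : ι → X)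

lemma mem_dictSpan_iff {I : Finset ι} {h : H} :
    h ∈ dictSpan H d I ↔ ∃ v : ι → ℝ, expansion H d I v = h := by
  constructor
  · intro hh
    obtain ⟨c, rfl⟩ := (Submodule.mem_span_image_finset_iff_exists_fun' ℝ).1 hh
    exact ⟨c, rfl⟩
  · rintro ⟨v, rfl⟩
    exact Submodule.sum_mem _ fun k hk => Submodule.smul_mem _ _
      (Submodule.subset_span ⟨k, hk, rfl⟩)

/-- A least squares fit over a dictionary is the orthogonal projection onto its span. -/
lemma expansion_eq_starProjection {I : Finset ι} {u : H} {w : ι → ℝ}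
    (hw : ∀ v : ι → ℝ, ‖u - expansion H d I w‖ ≤ ‖u - expansion H d I v‖) :
    expansion H d I w = (dictSpan H d I).starProjection u := by
  set e := expansion H d I w
  set q := (dictSpan H d I).starProjection u
  have hq : q ∈ dictSpan H d I := Submodule.starProjection_apply_mem _ _
  have he : e ∈ dictSpan H d I := (mem_dictSpan_iff d).2 ⟨w, rfl⟩
  obtain ⟨v, hv⟩ := (mem_dictSpan_iff d).1 hq
  have hle : ‖u - e‖ ≤ ‖u - q‖ := hv ▸ hw v
  have horth : inner ℝ (u - q) (q - e) = 0 :=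
    Submodule.starProjection_inner_eq_zero _ _ (Submodule.sub_mem _ hq he)
  have hpyth : ‖u - e‖ ^ 2 = ‖u - q‖ ^ 2 + ‖q - e‖ ^ 2 := by
    have h := norm_add_sq_real (u - q) (q - e)
    rw [horth, sub_add_sub_cancel] at h
    linarith
  have h0 : ‖q - e‖ ^ 2 ≤ 0 := by
    have := pow_le_pow_left₀ (norm_nonneg _) hle 2
    linarith
  have h1 : ‖q - e‖ = 0 := by
    have := sq_nonneg ‖q - e‖
    exact pow_eq_zero_iff two_ne_zero |>.1 (le_antisymm h0 this)
  exact (sub_eq_zero.1 (norm_eq_zero.1 h1)).symm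

variable [DecidableEq ι] {d} {Itil I : Finset ι} {wtil w : ι → ℝ} {ε : ℝ}

lemma KOMPReaches.subset (h : KOMPReaches H d Itil wtil ε I w) : I ⊆ Itil := by
  induction h with
  | init => exact subset_rfl
  | prune j w' _ _ _ _ _ ih => exact (Finset.erase_subset _ _).trans ih

lemma KOMPReaches.eq_starProjection (h : KOMPReaches H d Itil wtil ε I w) :
    expansion H d I w = (dictSpan H d I).starProjection (expansion H d Itil wtil) := by
  cases h with
  | init => exact (Submodule.starProjection_eq_self_iff.2 ((mem_dictSpan_iff d).2 ⟨_, rfl⟩)).symm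
  | prune j w' _ _ _ _ hmin => exact expansion_eq_starProjection d hmin

/-- Errors do not accumulate over passes: each refit is compared with the original input, so only
the last pass matters. -/
lemma KOMPReaches.norm_sub_le (hε : 0 ≤ ε) (h : KOMPReaches H d Itil wtil ε I w) :
    ‖expansion H d Itil wtil - expansion H d I w‖ ≤ ε := by
  cases h with
  | init => simpa using hε
  | prune j w' _ _ _ hle hmin => exact (le_ciInf hmin).trans hle

end Kernel

/-! ### Pathwise estimates along a run. -/

section Run

variable {X Y : Type*} {H : Type*} [NormedAddCommGroup H] [InnerProductSpace ℝ H]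
  [CompleteSpace H] [RKHS ℝ H X ℝ] {ℓ : ℝ → Y → ℝ} {lam : ℝ} {η ε : ℕ → ℝ}
  {x : ℕ → X} {y : ℕ → Y} {I : ℕ → Finset ℕ} {w : ℕ → ℕ → ℝ}

/-- Makes the label `t` fresh at step `t`, so that appending it overwrites no old coefficient. -/
lemma IsPOLKRun.subset_range (h : IsPOLKRun H ℓ lam η ε x y I w) (t : ℕ) :
    I t ⊆ Finset.range t := by
  induction t with
  | zero => simp [h.init]
  | succ t ih =>
    refine (h.step t).1.subset.trans ?_
    rw [Finset.range_add_one]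
    exact Finset.insert_subset_insert _ ih

/-- The input of KOMP at time `t` is a stochastic gradient step. -/
lemma IsPOLKRun.expansion_insert (h : IsPOLKRun H ℓ lam η ε x y I w) (t : ℕ) :
    expansion H x (insert t (I t))
      (fun i => if i = t then - η t * lossDeriv ℓ (expansion H x (I t) (w t) (x t)) (y t)
        else (1 - η t * lam) * w t i) =
    expansion H x (I t) (w t) -
      η t • stochGrad ℓ lam (expansion H x (I t) (w t)) (x t) (y t) := by
  have ht : t ∉ I t := fun hmem => by simpa using h.subset_range t hmem
  generalize hc : lossDeriv ℓ (expansion H x (I t) (w t) (x t)) (y t) = c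
  have hsum : ∑ i ∈ I t, (if i = t then - η t * c else (1 - η t * lam) * w t i) • feature H (x i)
      = (1 - η t * lam) • expansion H x (I t) (w t) := by
    rw [expansion, Finset.smul_sum]
    refine Finset.sum_congr rfl fun i hi => ?_
    rw [if_neg (show i ≠ t from fun hit => ht (hit ▸ hi)), mul_smul]
  rw [stochGrad, hc]
  conv_lhs => rw [expansion, Finset.sum_insert ht, hsum, if_pos rfl]
  module

lemma IsPOLKRun.expansion_succ_eq (h : IsPOLKRun H ℓ lam η ε x y I w) (t : ℕ) :
    expansion H x (I (t + 1)) (w (t + 1)) = (dictSpan H x (I (t + 1))).starProjection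
      (expansion H x (I t) (w t) -
        η t • stochGrad ℓ lam (expansion H x (I t) (w t)) (x t) (y t)) := by
  rw [← h.expansion_insert]
  exact (h.step t).1.eq_starProjection

lemma IsPOLKRun.norm_sub_expansion_succ_le (h : IsPOLKRun H ℓ lam η ε x y I w) (t : ℕ)
    (hε : 0 ≤ ε t) :
    ‖expansion H x (I t) (w t) - η t • stochGrad ℓ lam (expansion H x (I t) (w t)) (x t) (y t)
      - expansion H x (I (t + 1)) (w (t + 1))‖ ≤ ε t := by
  rw [← h.expansion_insert]
  exact (h.step t).1.norm_sub_le hε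

lemma IsPOLKRun.projGrad_eq (h : IsPOLKRun H ℓ lam η ε x y I w) (t : ℕ) :
    projGrad ℓ lam (η t) x (I (t + 1)) (expansion H x (I t) (w t)) (x t) (y t) =
      (η t)⁻¹ • (expansion H x (I t) (w t) - expansion H x (I (t + 1)) (w (t + 1))) := by
  rw [projGrad, h.expansion_succ_eq]

/-- The iterates of POLK stay in a fixed ball. -/
lemma IsPOLKRun.norm_expansion_le (h : IsPOLKRun H ℓ lam η ε x y I w) {B C : ℝ}
    (hlam : 0 < lam) (hη : ∀ t, 0 ≤ η t) (hηlam : ∀ t, η t * lam ≤ 1) (hC0 : 0 ≤ C)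
    (hC : ∀ z y, |lossDeriv ℓ z y| ≤ C) (hB : ∀ x : X, ‖feature H x‖ ≤ B) (t : ℕ) :
    ‖expansion H x (I t) (w t)‖ ≤ C * B / lam := by
  induction t with
  | zero =>
    have hB0 : 0 ≤ B := (norm_nonneg _).trans (hB (x 0))
    rw [h.init]
    simpa [expansion] using by positivity
  | succ t ih =>
    rw [h.expansion_succ_eq]
    refine (Submodule.norm_starProjection_apply_le _ _).trans ?_
    set f := expansion H x (I t) (w t)
    have hstep : f - η t • stochGrad ℓ lam f (x t) (y t) =
        (1 - η t * lam) • f - (η t * lossDeriv ℓ (f (x t)) (y t)) • feature H (x t) := by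
      rw [stochGrad]
      module
    rw [hstep]
    -- The radius `C * B / lam` is the fixed point of `ρ ↦ (1 - η t * lam) * ρ + η t * C * B`.
    calc _ ≤ (1 - η t * lam) * ‖f‖ + η t * |lossDeriv ℓ (f (x t)) (y t)| * ‖feature H (x t)‖ := by
          refine (norm_sub_le _ _).trans_eq ?_
          rw [norm_smul, norm_smul, Real.norm_of_nonneg (sub_nonneg.2 (hηlam t)), norm_mul,
            Real.norm_of_nonneg (hη t), Real.norm_eq_abs]
      _ ≤ (1 - η t * lam) * (C * B / lam) + η t * C * B := by
          have h1 := sub_nonneg.2 (hηlam t)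
          have h2 := hη t
          gcongr
          · exact hC _ _
          · exact hB _
      _ = C * B / lam := by field_simp; ring

/-- The one-step inequality for the distance to a point `g`. -/
lemma norm_sub_sq_le_of_approx_step {E : Type*} [NormedAddCommGroup E] [InnerProductSpace ℝ E]
    {f f' g v : E} {η ε : ℝ} (h : ‖f - η • v - f'‖ ≤ ε) :
    ‖f' - g‖ ^ 2 ≤ ‖f - g‖ ^ 2 - 2 * η * inner ℝ (f - g) v + 2 * ε * ‖f - g‖ + ‖f - f'‖ ^ 2 := by
  have h1 := norm_sub_sq_real (f - g) (f - f')
  rw [sub_sub_sub_cancel_left] at h1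
  -- The displacement `f - f'` is `η • v` plus a residual of norm at most `ε`, which Cauchy–Schwarz
  -- controls.
  have h2 : inner ℝ (f - g) (f - f') =
      η * inner ℝ (f - g) v + inner ℝ (f - g) (f - η • v - f') := by
    rw [← inner_smul_right, ← inner_add_right]
    congr 1
    abel
  have h3 : -(‖f - g‖ * ε) ≤ inner ℝ (f - g) (f - η • v - f') := by
    have := (abs_le.1 (abs_real_inner_le_norm (f - g) (f - η • v - f'))).1
    have := mul_le_mul_of_nonneg_left h (norm_nonneg (f - g))
    linarith
  linarith

/-- The gradient inequality for the regularized loss at one sample. -/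
lemma le_inner_stochGrad (hconv : ∀ y : Y, ConvexOn ℝ Set.univ (fun z => ℓ z y))
    (hdiff : ∀ y : Y, Differentiable ℝ (fun z => ℓ z y)) (f g : H) (x : X) (y : Y) :
    ℓ (f x) y - ℓ (g x) y + lam / 2 * (‖f‖ ^ 2 - ‖g‖ ^ 2 + ‖f - g‖ ^ 2) ≤
      inner ℝ (f - g) (stochGrad ℓ lam f x y) := by
  have htangent : ℓ (f x) y - ℓ (g x) y ≤ lossDeriv ℓ (f x) y * (f x - g x) := by
    have hd := (hdiff y (f x)).hasDerivAt
    rw [lossDeriv]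
    rcases lt_trichotomy (f x) (g x) with hlt | heq | hgt
    · have := (hconv y).le_slope_of_hasDerivAt (Set.mem_univ _) (Set.mem_univ _) hlt hd
      rw [slope_def_field, le_div_iff₀ (by linarith)] at this
      linarith
    · simp [heq]
    · have := (hconv y).slope_le_of_hasDerivAt (Set.mem_univ _) (Set.mem_univ _) hgt hd
      rw [slope_def_field, div_le_iff₀ (by linarith)] at this
      linarith
  -- An identity rather than a bound: the term `‖f - g‖ ^ 2` supplies one of the two contractions.
  have hreg : inner ℝ (f - g) f = (‖f‖ ^ 2 - ‖g‖ ^ 2 + ‖f - g‖ ^ 2) / 2 := by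
    rw [norm_sub_sq_real, inner_sub_left, real_inner_self_eq_norm_sq, real_inner_comm]
    ring
  rw [stochGrad, inner_add_right, inner_smul_right, inner_smul_right, inner_feature, hreg,
    RKHS.coe_sub, Pi.sub_apply]
  linarith

lemma abs_lossDeriv_le {C : ℝ} (hC : 0 ≤ C) (y : Y)
    (h : ∀ z z' : ℝ, |ℓ z y - ℓ z' y| ≤ C * |z - z'|) (z : ℝ) : |lossDeriv ℓ z y| ≤ C := by
  rw [lossDeriv, ← Real.norm_eq_abs]
  exact norm_deriv_le_of_lip' hC (Eventually.of_forall fun u => h u z)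

end Run

end POLK

namespace POLK

/-! ### Averaging over a sample independent of the past. -/

section Freezing

variable {Ω Q E : Type*} {m mΩ : MeasurableSpace Ω} {mQ : MeasurableSpace Q}
  [NormedAddCommGroup E]
  {μ : Measure Ω} [IsProbabilityMeasure μ] {P : Measure Q} {q : Ω → Q}
  {g : E → Q → ℝ} {L : ℝ} {F : Ω → E} {c : ℝ} {A : Set Ω}

lemma setIntegral_of_indep (hm : m ≤ mΩ) (hlaw : HasLaw q P μ)
    (hindep : Indep (MeasurableSpace.comap q mQ) m μ) (hq : Measurable q) {φ : Q → ℝ}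
    (hφ : Measurable φ) (hφi : Integrable φ P) (hA : MeasurableSet[m] A) :
    ∫ ω in A, φ (q ω) ∂μ = ∫ _ in A, (∫ z, φ z ∂P) ∂μ := by
  have hint : Integrable (fun ω => φ (q ω)) μ := by
    have := hφi
    rw [← hlaw.map_eq] at this
    exact this.comp_measurable hq
  have hmeas : StronglyMeasurable[MeasurableSpace.comap q mQ] (fun ω => φ (q ω)) :=
    (hφ.comp (comap_measurable q)).stronglyMeasurable
  have hce := condExp_indep_eq hq.comap_le hm hmeas hindep
  rw [← setIntegral_condExp hm hint hA]
  refine integral_congr_ae (ae_restrict_of_ae (hce.trans (ae_of_all _ fun _ => ?_)))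
  rw [← hlaw.integral_comp hφ.aestronglyMeasurable]
  rfl

lemma integrable_comp_of_lipschitz (hlaw : HasLaw q P μ) (hq : Measurable q)
    (hL : 0 ≤ L) (hlip : ∀ h h' z, |g h z - g h' z| ≤ L * ‖h - h'‖)
    (hgi : Integrable (g 0) P) (hF : AEStronglyMeasurable (fun ω => g (F ω) (q ω)) μ)
    (hc : ∀ ω, ‖F ω‖ ≤ c) : Integrable (fun ω => g (F ω) (q ω)) μ := by
  have hint : Integrable (fun ω => g 0 (q ω)) μ := by
    rw [← hlaw.map_eq] at hgi
    exact hgi.comp_measurable hq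
  refine Integrable.mono' (hint.norm.add (integrable_const (L * c))) hF (ae_of_all _ fun ω => ?_)
  have h1 := hlip (F ω) 0 (q ω)
  rw [sub_zero] at h1
  have h2 := mul_le_mul_of_nonneg_left (hc ω) hL
  have h3 := abs_sub_abs_le_abs_sub (g (F ω) (q ω)) (g 0 (q ω))
  simp only [Pi.add_apply, Real.norm_eq_abs]
  linarith

lemma integrable_of_lipschitz [IsProbabilityMeasure P]
    (hlip : ∀ h h' z, |g h z - g h' z| ≤ L * ‖h - h'‖)
    (hg : ∀ h, Measurable (g h)) (hgi : Integrable (g 0) P) (h : E) : Integrable (g h) P := by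
  refine Integrable.mono' (hgi.norm.add (integrable_const (L * ‖h‖)))
    (hg h).aestronglyMeasurable (ae_of_all _ fun z => ?_)
  have h1 := hlip h 0 z
  rw [sub_zero] at h1
  have h3 := abs_sub_abs_le_abs_sub (g h z) (g 0 z)
  simp only [Pi.add_apply, Real.norm_eq_abs]
  linarith

/-- On each fibre of `s` the first argument is constant, and `setIntegral_of_indep` applies there.
-/
lemma setIntegral_comp_of_finite_range [IsProbabilityMeasure P] (hm : m ≤ mΩ) (hlaw : HasLaw q P μ)
    (hindep : Indep (MeasurableSpace.comap q mQ) m μ) (hq : Measurable q)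
    (hlip : ∀ h h' z, |g h z - g h' z| ≤ L * ‖h - h'‖)
    (hg : ∀ h, Measurable (g h)) (hgi : Integrable (g 0) P)
    {s : Ω → E} (hs : ∀ h, MeasurableSet[m] (s ⁻¹' {h})) (hfin : (Set.range s).Finite)
    (hA : MeasurableSet[m] A) :
    ∫ ω in A, g (s ω) (q ω) ∂μ = ∫ ω in A, (∫ z, g (s ω) z ∂P) ∂μ := by
  have hAeq : A = ⋃ h ∈ hfin.toFinset, A ∩ s ⁻¹' {h} := by
    ext ω
    simp
  have hpiece : ∀ h, MeasurableSet[m] (A ∩ s ⁻¹' {h}) := fun h => hA.inter (hs h)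
  have hdisj : Set.PairwiseDisjoint (hfin.toFinset : Set E) fun h => A ∩ s ⁻¹' {h} := by
    intro a _ b _ hab
    refine Set.disjoint_left.2 fun ω ha hb => hab ?_
    exact ha.2.symm.trans hb.2
  have hint : ∀ h, Integrable (fun ω => g h (q ω)) μ := fun h => by
    have := integrable_of_lipschitz hlip hg hgi h
    rw [← hlaw.map_eq] at this
    exact this.comp_measurable hq
  have hcongr : ∀ h, ∀ ω ∈ A ∩ s ⁻¹' {h}, g (s ω) (q ω) = g h (q ω) := fun h ω hω => by
    rw [show s ω = h from hω.2]
  have hcongr' : ∀ h, ∀ ω ∈ A ∩ s ⁻¹' {h}, ∫ z, g (s ω) z ∂P = ∫ z, g h z ∂P := fun h ω hω => by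
    rw [show s ω = h from hω.2]
  conv_lhs => rw [hAeq]
  conv_rhs => rw [hAeq]
  rw [integral_biUnion_finset _ (fun h _ => hm _ (hpiece h)) hdisj,
    integral_biUnion_finset _ (fun h _ => hm _ (hpiece h)) hdisj]
  · refine Finset.sum_congr rfl fun h _ => ?_
    rw [setIntegral_congr_fun (hm _ (hpiece h)) (hcongr h),
      setIntegral_congr_fun (hm _ (hpiece h)) (hcongr' h)]
    exact setIntegral_of_indep hm hlaw hindep hq (hg h)
      (integrable_of_lipschitz hlip hg hgi h) (hpiece h)
  · intro h _
    exact (integrableOn_congr_fun (hcongr' h) (hm _ (hpiece h))).2 (integrable_const _).integrableOn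
  · intro h _
    exact (integrableOn_congr_fun (hcongr h) (hm _ (hpiece h))).2 (hint h).integrableOn

lemma tendsto_comp_of_lipschitz {u : ℕ → E} {e : E}
    (hlip : ∀ h h' z, |g h z - g h' z| ≤ L * ‖h - h'‖) (hu : Tendsto u atTop (𝓝 e)) (z : Q) :
    Tendsto (fun n => g (u n) z) atTop (𝓝 (g e z)) := by
  refine tendsto_iff_norm_sub_tendsto_zero.2 ?_
  have h := (tendsto_iff_norm_sub_tendsto_zero.1 hu).const_mul L
  rw [mul_zero] at h
  exact squeeze_zero (fun _ => norm_nonneg _) (fun n => hlip _ _ _) h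

/-- Approximating `F` by simple functions avoids any σ-algebra on `E` and any joint measurability of
`g`. -/
lemma measurable_comp_of_stronglyMeasurable (hm : m ≤ mΩ) (hq : Measurable q)
    (hlip : ∀ h h' z, |g h z - g h' z| ≤ L * ‖h - h'‖)
    (hg : ∀ h, Measurable (g h)) (hF : StronglyMeasurable[m] F) :
    Measurable fun ω => g (F ω) (q ω) := by
  have hF' := hF.mono hm
  refine measurable_of_tendsto_metrizable
    (f := fun n ω => g (hF'.approx n ω) (q ω)) (fun n => ?_) ?_
  · exact (hF'.approx n).measurable_bind (fun h ω => g h (q ω)) fun h => (hg h).comp hq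
  · exact tendsto_pi_nhds.2 fun ω => tendsto_comp_of_lipschitz hlip (hF'.tendsto_approx ω) _

variable [NormedSpace ℝ E] in
/-- If `F` is known at the time `m` and the sample `q` with law `P` is independent of `m`, then
`g (F, q)` may be averaged over `q` with `F` held fixed. -/
theorem setIntegral_comp_of_indep [IsProbabilityMeasure P] (hm : m ≤ mΩ) (hlaw : HasLaw q P μ)
    (hindep : Indep (MeasurableSpace.comap q mQ) m μ) (hq : Measurable q)
    (hL : 0 ≤ L) (hlip : ∀ h h' z, |g h z - g h' z| ≤ L * ‖h - h'‖)
    (hg : ∀ h, Measurable (g h)) (hgi : Integrable (g 0) P)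
    (hF : StronglyMeasurable[m] F) (hc : ∀ ω, ‖F ω‖ ≤ c) (hA : MeasurableSet[m] A) :
    ∫ ω in A, g (F ω) (q ω) ∂μ = ∫ ω in A, (∫ z, g (F ω) z ∂P) ∂μ := by
  obtain ⟨ω₀⟩ : Nonempty Ω := nonempty_of_isProbabilityMeasure μ
  have hc0 : 0 ≤ c := (norm_nonneg _).trans (hc ω₀)
  -- Truncated approximations keep the bound `c`, which gives both dominating functions below.
  set s := hF.approxBounded c
  have hs : ∀ ω, Tendsto (fun n => s n ω) atTop (𝓝 (F ω)) := fun ω =>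
    hF.tendsto_approxBounded_of_norm_le (hc ω)
  have hsc : ∀ n ω, ‖s n ω‖ ≤ c := fun n ω => hF.norm_approxBounded_le hc0 n ω
  have hdom : ∀ h z, ‖h‖ ≤ c → |g h z| ≤ |g 0 z| + L * c := fun h z hh => by
    have h1 := hlip h 0 z
    rw [sub_zero] at h1
    have h2 := mul_le_mul_of_nonneg_left hh hL
    have h3 := abs_sub_abs_le_abs_sub (g h z) (g 0 z)
    linarith
  have hint0 : Integrable (fun ω => g 0 (q ω)) μ := by
    have := hgi
    rw [← hlaw.map_eq] at this
    exact this.comp_measurable hq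
  have hlhs : Tendsto (fun n => ∫ ω in A, g (s n ω) (q ω) ∂μ) atTop
      (𝓝 (∫ ω in A, g (F ω) (q ω) ∂μ)) := by
    refine tendsto_integral_of_dominated_convergence (fun ω => |g 0 (q ω)| + L * c)
      (fun n => ?_) (hint0.abs.add (integrable_const _)).integrableOn
      (fun n => ae_of_all _ fun ω => hdom _ _ (hsc n ω))
      (ae_of_all _ fun ω => tendsto_comp_of_lipschitz hlip (hs ω) _)
    exact (measurable_comp_of_stronglyMeasurable hm hq hlip hg
      (s n).stronglyMeasurable).aestronglyMeasurable
  have hΦlip : ∀ h h', |(∫ z, g h z ∂P) - ∫ z, g h' z ∂P| ≤ L * ‖h - h'‖ := fun h h' => by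
    rw [← integral_sub (integrable_of_lipschitz hlip hg hgi h)
      (integrable_of_lipschitz hlip hg hgi h')]
    have := norm_integral_le_of_norm_le_const (μ := P)
      (ae_of_all _ fun z => (Real.norm_eq_abs _).trans_le (hlip h h' z))
    simpa using this
  have hΦ : Continuous fun h => ∫ z, g h z ∂P :=
    (LipschitzWith.of_dist_le_mul (K := L.toNNReal) fun h h' => by
      rw [Real.coe_toNNReal _ hL, dist_eq_norm, dist_eq_norm]
      exact hΦlip h h').continuous
  have hrhs : Tendsto (fun n => ∫ ω in A, (∫ z, g (s n ω) z ∂P) ∂μ) atTop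
      (𝓝 (∫ ω in A, (∫ z, g (F ω) z ∂P) ∂μ)) := by
    refine tendsto_integral_of_dominated_convergence (fun _ => |∫ z, g 0 z ∂P| + L * c)
      (fun n => ?_) (integrable_const _)
      (fun n => ae_of_all _ fun ω => ?_)
      (ae_of_all _ fun ω => (hΦ.tendsto _).comp (hs ω))
    · exact (hΦ.comp_stronglyMeasurable
        ((s n).stronglyMeasurable.mono hm)).aestronglyMeasurable
    · have h1 := hΦlip (s n ω) 0
      rw [sub_zero] at h1
      have h2 := mul_le_mul_of_nonneg_left (hsc n ω) hL
      have h3 := abs_sub_abs_le_abs_sub (∫ z, g (s n ω) z ∂P) (∫ z, g 0 z ∂P)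
      rw [Real.norm_eq_abs]
      linarith
  refine tendsto_nhds_unique hlhs (hrhs.congr fun n => ?_)
  exact (setIntegral_comp_of_finite_range hm hlaw hindep hq hlip hg hgi
    (fun h => @SimpleFunc.measurableSet_fiber Ω E m (s n) h)
    (@SimpleFunc.finite_range Ω E m (s n)) hA).symm

end Freezing

/-! ### Recurrence below a level from contraction above it. -/

section Supermartingale

variable {Ω : Type*} {mΩ : MeasurableSpace Ω} {μ : Measure Ω} [IsProbabilityMeasure μ]
  {𝓕 : Filtration ℕ mΩ} {V : ℕ → Ω → ℝ} {ρ a : ℝ}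

/-- A nonnegative process that contracts in mean by a fixed factor while it is above the level
`a` is almost surely at or below that level infinitely often. -/
theorem ae_frequently_le_of_contraction (hV0 : ∀ t ω, 0 ≤ V t ω)
    (hVm : ∀ t, Measurable[𝓕 t] (V t)) (hVi : ∀ t, Integrable (V t) μ) (ha : 0 < a)
    (hρ0 : 0 ≤ ρ) (hρ1 : ρ < 1)
    (hV : ∀ t (A : Set Ω), MeasurableSet[𝓕 t] A → (∀ ω ∈ A, a < V t ω) →
      ∫ ω in A, V (t + 1) ω ∂μ ≤ ρ * ∫ ω in A, V t ω ∂μ) :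
    ∀ᵐ ω ∂μ, ∃ᶠ t in atTop, V t ω ≤ a := by
  have hnull : ∀ T, μ {ω | ∀ k, a < V (T + k) ω} = 0 := by
    intro T
    -- `A n` is known at time `T + n`, so the contraction applies on it; since the sets decrease,
    -- the estimate iterates.
    let A : ℕ → Set Ω := fun n => {ω | ∀ k ≤ n, a < V (T + k) ω}
    have hA : ∀ n, MeasurableSet[𝓕 (T + n)] (A n) := fun n => by
      have : A n = ⋂ k ∈ Finset.range (n + 1), {ω | a < V (T + k) ω} := by
        ext ω
        simp [A]
      rw [this]
      refine Finset.measurableSet_biInter _ fun k hk => ?_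
      have hk' : k ≤ n := Nat.lt_succ_iff.1 (Finset.mem_range.1 hk)
      exact measurableSet_lt measurable_const
        ((hVm (T + k)).mono (𝓕.mono (Nat.add_le_add_left hk' T)) le_rfl)
    have hA' : ∀ n, MeasurableSet (A n) := fun n => 𝓕.le _ _ (hA n)
    have hdecay : ∀ n, ∫ ω in A n, V (T + n) ω ∂μ ≤ ρ ^ n * ∫ ω, V T ω ∂μ := by
      intro n
      induction n with
      | zero =>
        simpa using setIntegral_le_integral (hVi T) (ae_of_all _ (hV0 T))
      | succ n ih =>
        calc ∫ ω in A (n + 1), V (T + n + 1) ω ∂μ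
            ≤ ∫ ω in A n, V (T + n + 1) ω ∂μ :=
              setIntegral_mono_set (hVi _).integrableOn (ae_of_all _ (hV0 _))
                (ae_of_all _ fun ω hω k hk => hω k (hk.trans n.le_succ))
          _ ≤ ρ * ∫ ω in A n, V (T + n) ω ∂μ := hV _ _ (hA n) fun ω hω => hω n le_rfl
          _ ≤ ρ * (ρ ^ n * ∫ ω, V T ω ∂μ) := mul_le_mul_of_nonneg_left ih hρ0
          _ = ρ ^ (n + 1) * ∫ ω, V T ω ∂μ := by ring
    -- Markov's inequality: `V (T + n)` exceeds `a` on `A n`, which contains the event for every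
    -- `n`.
    have hbound : ∀ n, a * μ.real {ω | ∀ k, a < V (T + k) ω} ≤ ρ ^ n * ∫ ω, V T ω ∂μ := by
      intro n
      refine le_trans ?_ (hdecay n)
      calc a * μ.real {ω | ∀ k, a < V (T + k) ω} ≤ a * μ.real (A n) :=
            mul_le_mul_of_nonneg_left (measureReal_mono fun ω hω k _ => hω k) ha.le
        _ = ∫ _ in A n, a ∂μ := by simp [mul_comm]
        _ ≤ ∫ ω in A n, V (T + n) ω ∂μ :=
            setIntegral_mono_on (integrable_const _).integrableOn (hVi _).integrableOn (hA' n)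
              fun ω hω => (hω n le_rfl).le
    have hlim : Tendsto (fun n => ρ ^ n * ∫ ω, V T ω ∂μ) atTop (𝓝 0) := by
      simpa using (tendsto_pow_atTop_nhds_zero_of_lt_one hρ0 hρ1).mul_const (∫ ω, V T ω ∂μ)
    have h0 : a * μ.real {ω | ∀ k, a < V (T + k) ω} ≤ 0 := ge_of_tendsto' hlim hbound
    have h1 : μ.real {ω | ∀ k, a < V (T + k) ω} = 0 :=
      le_antisymm (nonpos_of_mul_nonpos_right h0 ha) measureReal_nonneg
    exact (measureReal_eq_zero_iff).1 h1
  have hall : ∀ᵐ ω ∂μ, ∀ T, ¬ ∀ k, a < V (T + k) ω :=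
    ae_all_iff.2 fun T => measure_eq_zero_iff_ae_notMem.1 (hnull T)
  filter_upwards [hall] with ω hω
  refine frequently_atTop.2 fun T => ?_
  obtain ⟨k, hk⟩ := not_forall.1 (hω T)
  exact ⟨T + k, Nat.le_add_right _ _, not_lt.1 hk⟩

end Supermartingale

end POLK

namespace POLK

/-! ### Strong convexity of the risk and the threshold quadratic. -/

section Risk

variable {X Y : Type*} [MeasurableSpace X] [MeasurableSpace Y] {H : Type*} [NormedAddCommGroup H]
  [InnerProductSpace ℝ H] [CompleteSpace H] [RKHS ℝ H X ℝ] {ℓ : ℝ → Y → ℝ} {lam : ℝ}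
  {P : Measure (X × Y)}

omit [CompleteSpace H] in
lemma measurable_loss (hmeas : ∀ z : ℝ, Measurable (ℓ z))
    (hdiff : ∀ y : Y, Differentiable ℝ (fun z => ℓ z y))
    (hH : ∀ h : H, Measurable (fun x : X => h x)) (h : H) :
    Measurable fun q : X × Y => ℓ (h q.1) q.2 :=
  (measurable_uncurry_of_continuous_of_measurable (fun y => (hdiff y).continuous) hmeas).comp
    (((hH h).comp measurable_fst).prodMk measurable_snd)

/-- The growth of the regularized risk away from its minimizer. -/
lemma le_risk_sub_risk_of_isMin
    (hconv : ∀ y : Y, ConvexOn ℝ Set.univ (fun z => ℓ z y))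
    (hint : ∀ h : H, Integrable (fun q : X × Y => ℓ (h q.1) q.2) P) {g : H}
    (hmin : ∀ h : H, risk ℓ lam P g ≤ risk ℓ lam P h) (f : H) :
    lam / 2 * ‖f - g‖ ^ 2 ≤ risk ℓ lam P f - risk ℓ lam P g := by
  -- Compare `g` with the point `(1 - s) • g + s • f`, divide by `s`, then let `s` tend to `0`; the
  -- risk need not be differentiated.
  have key : ∀ s ∈ Set.Ioo (0 : ℝ) 1,
      (1 - s) * (lam / 2 * ‖f - g‖ ^ 2) ≤ risk ℓ lam P f - risk ℓ lam P g := by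
    rintro s ⟨hs0, hs1⟩
    have h1 : ∫ q, ℓ (((1 - s) • g + s • f) q.1) q.2 ∂P ≤
        (1 - s) * (∫ q, ℓ (g q.1) q.2 ∂P) + s * ∫ q, ℓ (f q.1) q.2 ∂P := by
      rw [← integral_const_mul, ← integral_const_mul,
        ← integral_add ((hint g).const_mul _) ((hint f).const_mul _)]
      refine integral_mono (hint _) (((hint g).const_mul _).add ((hint f).const_mul _)) fun q => ?_
      have := (hconv q.2).2 (Set.mem_univ (g q.1)) (Set.mem_univ (f q.1))
        (sub_nonneg.2 hs1.le) hs0.le (sub_add_cancel 1 s)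
      simpa [RKHS.coe_add, RKHS.coe_smul] using this
    have h2 : ‖(1 - s) • g + s • f‖ ^ 2 =
        (1 - s) * ‖g‖ ^ 2 + s * ‖f‖ ^ 2 - s * (1 - s) * ‖f - g‖ ^ 2 := by
      rw [norm_add_sq_real, norm_sub_sq_real, norm_smul, norm_smul, inner_smul_left,
        inner_smul_right, real_inner_comm, mul_pow, mul_pow, Real.norm_eq_abs, Real.norm_eq_abs,
        sq_abs, sq_abs]
      simp only [conj_trivial]
      ring
    have h3 := hmin ((1 - s) • g + s • f)
    simp only [risk] at h3 ⊢
    rw [h2] at h3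
    refine le_of_mul_le_mul_left ?_ hs0
    linarith
  have hlim : Tendsto (fun s : ℝ => (1 - s) * (lam / 2 * ‖f - g‖ ^ 2)) (𝓝[>] 0)
      (𝓝 (lam / 2 * ‖f - g‖ ^ 2)) := by
    have : Continuous fun s : ℝ => (1 - s) * (lam / 2 * ‖f - g‖ ^ 2) := by fun_prop
    simpa using (this.tendsto 0).mono_left nhdsWithin_le_nhds
  exact le_of_tendsto hlim
    (eventually_of_mem (Ioo_mem_nhdsGT one_pos) key)

end Risk

/-- Above the root of the quadratic `lam d² - 2 K √η d - η σ²`, the quadratic is nonnegative. -/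
lemma quadratic_nonneg_of_root_le {lam η K σ d : ℝ} (hlam : 0 < lam) (hη : 0 ≤ η)
    (hd : √η / lam * (K + √(K ^ 2 + lam * σ ^ 2)) ≤ d) :
    2 * (K * √η) * d + η * σ ^ 2 ≤ lam * d ^ 2 := by
  have hr : 0 ≤ K ^ 2 + lam * σ ^ 2 := by positivity
  have hs := Real.sq_sqrt hr
  have hη2 := Real.sq_sqrt hη
  have hr0 := Real.sqrt_nonneg (K ^ 2 + lam * σ ^ 2)
  have hη0 := Real.sqrt_nonneg η
  set r := √(K ^ 2 + lam * σ ^ 2)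
  set e := √η
  have h1 : e * (K + r) ≤ lam * d := by
    rw [div_mul_eq_mul_div, div_le_iff₀ hlam] at hd
    linarith
  -- Completing the square after multiplying the quadratic by `lam`.
  have h2 : (e * r) ^ 2 ≤ (lam * d - e * K) ^ 2 :=
    pow_le_pow_left₀ (by positivity) (by linarith) 2
  have h3 : 0 ≤ lam * (lam * d ^ 2 - (2 * (K * e) * d + η * σ ^ 2)) := by
    have : (e * r) ^ 2 = η * (K ^ 2 + lam * σ ^ 2) := by rw [mul_pow, hs, hη2]
    have : (e * K) ^ 2 = η * K ^ 2 := by rw [mul_pow, hη2]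
    nlinarith
  linarith [nonneg_of_mul_nonneg_right h3 hlam]

/-! ### The mean one-step decrease. -/

section Drift

variable {X Y : Type*} [MeasurableSpace X] [MeasurableSpace Y] {H : Type*} [NormedAddCommGroup H]
  [InnerProductSpace ℝ H] [CompleteSpace H] [RKHS ℝ H X ℝ] {ℓ : ℝ → Y → ℝ} {lam : ℝ}
  {P : Measure (X × Y)} [IsProbabilityMeasure P]
  {Ω : Type*} {m mΩ : MeasurableSpace Ω} {μ : Measure Ω} [IsProbabilityMeasure μ]

/-- The mean decrease of the squared distance to the minimizer of the risk in one inexact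
stochastic gradient step, on an event that is known before the sample is drawn. -/
theorem setIntegral_norm_sub_sq_le (hm : m ≤ mΩ)
    (hH : ∀ h : H, Measurable (fun x : X => h x)) {B C : ℝ}
    (hB : ∀ x : X, ‖feature H x‖ ≤ B) (hB0 : 0 ≤ B) (hC0 : 0 ≤ C)
    (hmeas : ∀ z : ℝ, Measurable (ℓ z))
    (hlip : ∀ (y : Y) (z z' : ℝ), |ℓ z y - ℓ z' y| ≤ C * |z - z'|)
    (hconv : ∀ y : Y, ConvexOn ℝ Set.univ (fun z => ℓ z y))
    (hdiff : ∀ y : Y, Differentiable ℝ (fun z => ℓ z y))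
    (hint : Integrable (fun q : X × Y => ℓ 0 q.2) P)
    {q : Ω → X × Y} (hq : Measurable q) (hlaw : HasLaw q P μ)
    (hindep : Indep (MeasurableSpace.comap q inferInstance) m μ)
    {F F' : Ω → H} (hF : StronglyMeasurable[m] F) (hF' : StronglyMeasurable[mΩ] F') {c : ℝ}
    (hc : ∀ ω, ‖F ω‖ ≤ c) (hc' : ∀ ω, ‖F' ω‖ ≤ c) {η ε S : ℝ} (hη : 0 ≤ η)
    (hstep : ∀ ω, ‖F ω - η • stochGrad ℓ lam (F ω) (q ω).1 (q ω).2 - F' ω‖ ≤ ε)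
    (hS : μ[fun ω => ‖F ω - F' ω‖ ^ 2 | m] ≤ᵐ[μ] fun _ => S)
    {g : H} (hmin : ∀ h : H, risk ℓ lam P g ≤ risk ℓ lam P h)
    {A : Set Ω} (hA : MeasurableSet[m] A) :
    ∫ ω in A, ‖F' ω - g‖ ^ 2 ∂μ ≤
      ∫ ω in A, ((1 - 2 * η * lam) * ‖F ω - g‖ ^ 2 + 2 * ε * ‖F ω - g‖ + S) ∂μ := by
  let G : H → X × Y → ℝ := fun h z => ℓ (h z.1) z.2
  have hGlip : ∀ h h' z, |G h z - G h' z| ≤ C * B * ‖h - h'‖ := fun h h' z => by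
    refine (hlip z.2 _ _).trans ?_
    rw [mul_assoc]
    refine mul_le_mul_of_nonneg_left ?_ hC0
    simpa [RKHS.coe_sub] using abs_apply_le hB (h - h') z.1
  have hGm : ∀ h, Measurable (G h) := measurable_loss hmeas hdiff hH
  have hG0 : Integrable (G 0) P := by simpa [G] using hint
  have hGi := integrable_of_lipschitz hGlip hGm hG0
  have hGg : Integrable (fun ω => G g (q ω)) μ := by
    have := hGi g
    rw [← hlaw.map_eq] at this
    exact this.comp_measurable hq
  have hGF : Integrable (fun ω => G (F ω) (q ω)) μ :=
    integrable_comp_of_lipschitz hlaw hq (mul_nonneg hC0 hB0) hGlip hG0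
      (measurable_comp_of_stronglyMeasurable hm hq hGlip hGm hF).aestronglyMeasurable hc
  have hbdd : ∀ {u : Ω → ℝ} (M : ℝ), AEStronglyMeasurable u μ → (∀ ω, |u ω| ≤ M) →
      Integrable u μ := fun M hu hM => Integrable.of_bound hu M (ae_of_all _ hM)
  have hFm := hF.mono hm
  have hFsq : Integrable (fun ω => ‖F ω‖ ^ 2) μ :=
    hbdd (c ^ 2) (hFm.norm.pow 2).aestronglyMeasurable fun ω => by
      rw [abs_of_nonneg (sq_nonneg _)]
      exact pow_le_pow_left₀ (norm_nonneg _) (hc ω) 2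
  have hFg : ∀ ω, ‖F ω - g‖ ≤ c + ‖g‖ := fun ω => (norm_sub_le _ _).trans (by gcongr; exact hc ω)
  have hd : Integrable (fun ω => ‖F ω - g‖) μ :=
    hbdd (c + ‖g‖) (hFm.sub stronglyMeasurable_const).norm.aestronglyMeasurable fun ω => by
      rw [abs_of_nonneg (norm_nonneg _)]
      exact hFg ω
  have hdsq : Integrable (fun ω => ‖F ω - g‖ ^ 2) μ :=
    hbdd ((c + ‖g‖) ^ 2) ((hFm.sub stronglyMeasurable_const).norm.pow 2).aestronglyMeasurable
      fun ω => by
      rw [abs_of_nonneg (sq_nonneg _)]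
      exact pow_le_pow_left₀ (norm_nonneg _) (hFg ω) 2
  have hdsq' : Integrable (fun ω => ‖F' ω - g‖ ^ 2) μ :=
    hbdd ((c + ‖g‖) ^ 2) ((hF'.sub stronglyMeasurable_const).norm.pow 2).aestronglyMeasurable
      fun ω => by
      rw [abs_of_nonneg (sq_nonneg _)]
      refine pow_le_pow_left₀ (norm_nonneg _) ((norm_sub_le _ _).trans ?_) 2
      gcongr
      exact hc' ω
  have hN : Integrable (fun ω => ‖F ω - F' ω‖ ^ 2) μ :=
    hbdd ((c + c) ^ 2) ((hFm.sub hF').norm.pow 2).aestronglyMeasurable fun ω => by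
      rw [abs_of_nonneg (sq_nonneg _)]
      exact pow_le_pow_left₀ (norm_nonneg _)
        ((norm_sub_le _ _).trans (add_le_add (hc ω) (hc' ω))) 2
  have hNA : ∫ ω in A, ‖F ω - F' ω‖ ^ 2 ∂μ ≤ ∫ _ in A, S ∂μ := by
    rw [← setIntegral_condExp hm hN hA]
    exact integral_mono_ae integrable_condExp.integrableOn (integrable_const _)
      (ae_restrict_of_ae hS)
  have hfreeze : ∫ ω in A, G (F ω) (q ω) ∂μ = ∫ ω in A, (∫ z, G (F ω) z ∂P) ∂μ :=
    setIntegral_comp_of_indep hm hlaw hindep hq (mul_nonneg hC0 hB0) hGlip hGm hG0 hF hc hA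
  have hfreeze' : ∫ ω in A, G g (q ω) ∂μ = ∫ _ in A, (∫ z, G g z ∂P) ∂μ :=
    setIntegral_of_indep hm hlaw hindep hq (hGm g) (hGi g) hA
  set Φ : H → ℝ := fun h => ∫ z, G h z ∂P with hΦ
  have hΦi : Integrable (fun ω => Φ (F ω)) μ := by
    have hlipΦ : ∀ h h' (_ : X × Y), |Φ h - Φ h'| ≤ C * B * ‖h - h'‖ := fun h h' _ => by
      rw [hΦ, ← integral_sub (hGi h) (hGi h')]
      have := norm_integral_le_of_norm_le_const (μ := P)
        (ae_of_all _ fun z => (Real.norm_eq_abs _).trans_le (hGlip h h' z))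
      simpa using this
    exact integrable_comp_of_lipschitz (g := fun h _ => Φ h) hlaw hq (mul_nonneg hC0 hB0) hlipΦ
      (integrable_const _) (measurable_comp_of_stronglyMeasurable (g := fun h _ => Φ h) hm hq
        hlipΦ (fun _ => measurable_const) hF).aestronglyMeasurable hc
  -- `W` collects the terms that do not involve the new sample. Its coefficient `1 - η * lam`
  -- already contains the contraction from the gradient inequality; its last term completes the loss
  -- difference to a risk difference.
  set W : Ω → ℝ := fun ω => (1 - η * lam) * ‖F ω - g‖ ^ 2 + 2 * ε * ‖F ω - g‖ -
    η * lam * (‖F ω‖ ^ 2 - ‖g‖ ^ 2) with hW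
  have hWi : Integrable W μ :=
    ((hdsq.const_mul _).add (hd.const_mul _)).sub ((hFsq.sub (integrable_const _)).const_mul _)
  have hsplit : ∀ {u v v' n : Ω → ℝ} {k : ℝ}, Integrable u μ → Integrable v μ → Integrable v' μ →
      Integrable n μ → ∫ ω in A, (u ω - k * (v ω - v' ω) + n ω) ∂μ =
        ∫ ω in A, u ω ∂μ - k * (∫ ω in A, v ω ∂μ - ∫ ω in A, v' ω ∂μ) + ∫ ω in A, n ω ∂μ := by
    intro u v v' n k hu hv hv' hn
    have hkv : Integrable (fun ω => k * (v ω - v' ω)) μ := (hv.sub hv').const_mul k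
    have huv : Integrable (fun ω => u ω - k * (v ω - v' ω)) μ := hu.sub hkv
    rw [integral_add huv.integrableOn hn.integrableOn, integral_sub hu.integrableOn
      hkv.integrableOn, integral_const_mul, integral_sub hv.integrableOn hv'.integrableOn]
  calc ∫ ω in A, ‖F' ω - g‖ ^ 2 ∂μ
      ≤ ∫ ω in A, (W ω - 2 * η * (G (F ω) (q ω) - G g (q ω)) + ‖F ω - F' ω‖ ^ 2) ∂μ := by
        refine integral_mono hdsq'.integrableOn
          ((hWi.sub ((hGF.sub hGg).const_mul _)).add hN).integrableOn fun ω => ?_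
        have h1 := norm_sub_sq_le_of_approx_step (g := g) (hstep ω)
        have h2 := mul_le_mul_of_nonneg_left
          (le_inner_stochGrad (lam := lam) hconv hdiff (F ω) g (q ω).1 (q ω).2) hη
        simp only [hW, G]
        linarith
    _ = ∫ ω in A, W ω ∂μ - 2 * η * (∫ ω in A, G (F ω) (q ω) ∂μ - ∫ ω in A, G g (q ω) ∂μ)
          + ∫ ω in A, ‖F ω - F' ω‖ ^ 2 ∂μ :=
        hsplit hWi hGF hGg hN
    _ ≤ ∫ ω in A, W ω ∂μ - 2 * η * (∫ ω in A, Φ (F ω) ∂μ - ∫ _ in A, Φ g ∂μ)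
          + ∫ _ in A, S ∂μ := by
        rw [hfreeze, hfreeze']
        gcongr
    _ = ∫ ω in A, (W ω - 2 * η * (Φ (F ω) - Φ g) + S) ∂μ :=
        (hsplit hWi hΦi (integrable_const _) (integrable_const _)).symm
    _ ≤ _ := by
        refine integral_mono
          ((hWi.sub ((hΦi.sub (integrable_const _)).const_mul _)).add
            (integrable_const _)).integrableOn
          (((hdsq.const_mul _).add (hd.const_mul _)).add (integrable_const _)).integrableOn
          fun ω => ?_
        -- The growth of the risk supplies the second contraction, turning `1 - η * lam` into `1 - 2
        -- * η * lam`.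
        have h1 := mul_le_mul_of_nonneg_left
          (le_risk_sub_risk_of_isMin hconv hGi hmin (F ω)) hη
        simp only [risk] at h1
        simp only [hW, hΦ, G]
        linarith

end Drift

end POLK

/-! ### Assembling the estimates. -/

theorem theorem2
    {p : ℕ} {𝒳 : Set (EuclideanSpace ℝ (Fin p))} {𝒴 : Set ℝ}
    (h𝒳 : IsCompact 𝒳) (h𝒴 : IsCompact 𝒴)
    {H : Type*} [NormedAddCommGroup H] [InnerProductSpace ℝ H] [CompleteSpace H]
    [RKHS ℝ H 𝒳 ℝ]
    (hH_meas : ∀ h : H, Measurable (fun x : 𝒳 => h x))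
    (hκ : BddAbove (Set.range fun x : 𝒳 => √(POLK.kappa H x x)))
    (ℓ : ℝ → 𝒴 → ℝ)
    (hℓ_meas : ∀ z : ℝ, Measurable (ℓ z))
    (C : ℝ) (hℓ_lip : ∀ (y : 𝒴) (z z' : ℝ), |ℓ z y - ℓ z' y| ≤ C * |z - z'|)
    (hℓ_conv : ∀ y : 𝒴, ConvexOn ℝ Set.univ (fun z => ℓ z y))
    (hℓ_diff : ∀ y : 𝒴, Differentiable ℝ (fun z => ℓ z y))
    {Ω : Type*} {mΩ : MeasurableSpace Ω} (μ : Measure Ω) [IsProbabilityMeasure μ]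
    (P : Measure (𝒳 × 𝒴))
    (hℓ_int : Integrable (fun q : 𝒳 × 𝒴 => ℓ 0 q.2) P)
    (x : ℕ → Ω → 𝒳) (y : ℕ → Ω → 𝒴) (I : ℕ → Ω → Finset ℕ) (w : ℕ → Ω → ℕ → ℝ)
    (f : ℕ → Ω → H)
    (hf : ∀ t ω, f t ω = POLK.expansion H (fun i => x i ω) (I t ω) (w t ω))
    -- `𝓕 t` is the algorithm history before the sample `(x t, y t)` is drawn
    (𝓕 : Filtration ℕ mΩ)
    (hx_meas : ∀ t, Measurable[𝓕 (t + 1)] (x t))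
    (hy_meas : ∀ t, Measurable[𝓕 (t + 1)] (y t))
    (hf_meas : ∀ t, StronglyMeasurable[𝓕 t] (f t))
    (hlaw : ∀ t, HasLaw (fun ω => (x t ω, y t ω)) P μ)
    (hindep : ∀ t, Indep
      (MeasurableSpace.comap (fun ω => (x t ω, y t ω)) inferInstance) (𝓕 t) μ)
    (lam η K σ : ℝ) (hlam : 0 < lam) (hη : 0 < η) (hη_lt : η < 1 / lam) (hK : 0 < K)
    (hrun : ∀ ω, POLK.IsPOLKRun H ℓ lam (fun _ => η) (fun _ => K * η ^ (3 / 2 : ℝ))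
      (fun t => x t ω) (fun t => y t ω) (fun t => I t ω) (fun t => w t ω))
    (hσ : ∀ t, μ[fun ω => ‖POLK.projGrad ℓ lam η (fun i => x i ω) (I (t + 1) ω)
      (f t ω) (x t ω) (y t ω)‖ ^ 2 | 𝓕 t] ≤ᵐ[μ] fun _ => σ ^ 2)
    (fstar : H) (hfstar : ∀ g : H, POLK.risk ℓ lam P fstar ≤ POLK.risk ℓ lam P g) :
    (∀ᵐ ω ∂μ, liminf (fun t => ((‖f t ω - fstar‖ : ℝ) : EReal)) atTop ≤
      ((√η / lam * (K + √(K ^ 2 + lam * σ ^ 2)) : ℝ) : EReal)) ∧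
    (fun s : ℝ => √s / lam * (K + √(K ^ 2 + lam * σ ^ 2))) =O[𝓝[>] 0] (fun s : ℝ => √s) := by
  refine ⟨?_, ?_⟩
  · obtain ⟨ω₀⟩ : Nonempty Ω := nonempty_of_isProbabilityMeasure μ
    obtain ⟨B, hB⟩ : ∃ B, ∀ z : 𝒳, ‖POLK.feature H z‖ ≤ B := by
      obtain ⟨B, hB⟩ := hκ
      exact ⟨B, fun z => POLK.sqrt_kappa_eq_norm_feature (H := H) z ▸ hB ⟨z, rfl⟩⟩
    have hB0 : 0 ≤ B := (norm_nonneg _).trans (hB (x 0 ω₀))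
    have hC0 : 0 ≤ C := by
      have := (abs_nonneg _).trans (hℓ_lip (y 0 ω₀) 1 0)
      simpa using this
    have hηlam : η * lam < 1 := (lt_div_iff₀ hlam).1 hη_lt
    -- The budget is `η` times `K * √η`, so a factor `η` comes out of the whole drift.
    have hεeq : K * η ^ (3 / 2 : ℝ) = η * (K * √η) := by
      rw [show (3 / 2 : ℝ) = 1 + 1 / 2 by norm_num, Real.rpow_add hη, Real.rpow_one,
        ← Real.sqrt_eq_rpow]
      ring
    have hε : 0 ≤ K * η ^ (3 / 2 : ℝ) := by positivity
    have hq : ∀ t, Measurable fun ω => (x t ω, y t ω) := fun t =>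
      ((hx_meas t).mono (𝓕.le _) le_rfl).prodMk ((hy_meas t).mono (𝓕.le _) le_rfl)
    have : IsProbabilityMeasure P := by
      rw [← (hlaw 0).map_eq]
      exact Measure.isProbabilityMeasure_map (hq 0).aemeasurable
    have hbound : ∀ t ω, ‖f t ω‖ ≤ C * B / lam := fun t ω => by
      rw [hf]
      exact (hrun ω).norm_expansion_le hlam (fun _ => hη.le) (fun _ => hηlam.le) hC0
        (fun z y => POLK.abs_lossDeriv_le hC0 y (hℓ_lip y) z) hB t
    have hstep : ∀ t ω, ‖f t ω - η • POLK.stochGrad ℓ lam (f t ω) (x t ω) (y t ω) - f (t + 1) ω‖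
        ≤ K * η ^ (3 / 2 : ℝ) := fun t ω => by
      rw [hf t, hf (t + 1)]
      exact (hrun ω).norm_sub_expansion_succ_le t hε
    have hfm : ∀ t, StronglyMeasurable[mΩ] (f t) := fun t => (hf_meas t).mono (𝓕.le t)
    have hS : ∀ t, μ[fun ω => ‖f t ω - f (t + 1) ω‖ ^ 2 | 𝓕 t] ≤ᵐ[μ] fun _ => η ^ 2 * σ ^ 2 := by
      intro t
      have heq : (fun ω => ‖f t ω - f (t + 1) ω‖ ^ 2) = η ^ 2 •
          fun ω => ‖POLK.projGrad ℓ lam η (fun i => x i ω) (I (t + 1) ω)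
            (f t ω) (x t ω) (y t ω)‖ ^ 2 := by
        ext ω
        have h := (hrun ω).projGrad_eq t
        rw [Pi.smul_apply, smul_eq_mul, hf t, hf (t + 1), h, norm_smul, mul_pow, norm_inv,
          Real.norm_of_nonneg hη.le, inv_pow, mul_inv_cancel_left₀ (by positivity)]
      rw [heq]
      filter_upwards [condExp_smul (μ := μ) (η ^ 2) (fun ω => ‖POLK.projGrad ℓ lam η
        (fun i => x i ω) (I (t + 1) ω) (f t ω) (x t ω) (y t ω)‖ ^ 2) (𝓕 t), hσ t] with ω h1 h2
      rw [h1, Pi.smul_apply, smul_eq_mul]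
      exact mul_le_mul_of_nonneg_left h2 (sq_nonneg η)
    set r := √η / lam * (K + √(K ^ 2 + lam * σ ^ 2)) with hr
    have hr0 : 0 < r := by positivity
    have hVi : ∀ t, Integrable (fun ω => ‖f t ω - fstar‖ ^ 2) μ := fun t =>
      Integrable.of_bound (((hfm t).sub stronglyMeasurable_const).norm.pow 2).aestronglyMeasurable
        ((C * B / lam + ‖fstar‖) ^ 2) (ae_of_all _ fun ω => by
          rw [Real.norm_of_nonneg (sq_nonneg _)]
          refine pow_le_pow_left₀ (norm_nonneg _) ((norm_sub_le _ _).trans ?_) 2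
          gcongr
          exact hbound t ω)
    have hfreq := POLK.ae_frequently_le_of_contraction (μ := μ) (𝓕 := 𝓕)
      (V := fun t ω => ‖f t ω - fstar‖ ^ 2) (ρ := 1 - η * lam) (a := r ^ 2)
      (fun _ _ => sq_nonneg _)
      (fun t => (((hf_meas t).sub stronglyMeasurable_const).norm.pow 2).measurable)
      hVi (by positivity) (by linarith) (by linarith [mul_pos hη hlam]) (by
        intro t A hA hAr
        refine (POLK.setIntegral_norm_sub_sq_le (𝓕.le t) hH_meas hB hB0 hC0 hℓ_meas hℓ_lip
          hℓ_conv hℓ_diff hℓ_int (hq t) (hlaw t) (hindep t) (hf_meas t) (hfm (t + 1))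
          (hbound t) (hbound (t + 1)) hη.le (hstep t) (hS t) hfstar hA).trans ?_
        rw [← integral_const_mul]
        have hdi : Integrable (fun ω => ‖f t ω - fstar‖) μ :=
          Integrable.of_bound ((hfm t).sub stronglyMeasurable_const).norm.aestronglyMeasurable
            (C * B / lam + ‖fstar‖) (ae_of_all _ fun ω => by
              rw [norm_norm]
              refine (norm_sub_le _ _).trans ?_
              gcongr
              exact hbound t ω)
        refine setIntegral_mono_on
          ((((hVi t).const_mul _).add (hdi.const_mul _)).add (integrable_const _)).integrableOn
          ((hVi t).const_mul _).integrableOn (𝓕.le t _ hA) fun ω hω => ?_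
        have hd : r ≤ ‖f t ω - fstar‖ := (lt_of_pow_lt_pow_left₀ 2 (norm_nonneg _) (hAr ω hω)).le
        -- One `η * lam` of the contraction absorbs the budget and variance terms; the other leaves
        -- `ρ = 1 - η * lam`.
        have h := mul_le_mul_of_nonneg_left
          (POLK.quadratic_nonneg_of_root_le hlam hη.le hd) hη.le
        rw [hεeq]
        linarith)
    filter_upwards [hfreq] with ω hω
    -- In `EReal` the liminf needs no boundedness condition.
    refine liminf_le_of_frequently_le' (hω.mono fun t ht => ?_)
    exact EReal.coe_le_coe_iff.2 (le_of_sq_le_sq ht hr0.le)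
  · refine IsBigO.of_bound (|(K + √(K ^ 2 + lam * σ ^ 2)) / lam|) (Eventually.of_forall fun s => ?_)
    rw [← Real.norm_eq_abs, ← norm_mul]
    exact le_of_eq (congrArg _ (by ring))
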